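/- Write $e(x)=e^{2\pi i x}$. Let $C>0$, $U\geq 5$ and $0<c_1<c_2$ be fixed real numbers. Let $Q>1$ be a real number, let $A,B$ be real numbers with $Q^5\leq |A|\leq Q^U$ and $|B|\leq |A|$, and let $M,N$ be integers with $c_1Q\leq M$ and $N\leq c_2Q$. Then $$\left|\sum_{M\leq n\leq N} e\left(A(n^2+n^{-2})+B(n+n^{-3})\right)\right|\leq K\,\frac{Q}{(\log Q)^C},$$ where $n$ runs over integers and the constant $K>0$ depends only on $C$, $U$, $c_1$, $c_2$ (and not on $Q$, $A$, $B$, $M$, $N$). -/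

import Mathlib

/-- The additive character `e(x) = exp(2 π i x)` on the real line. -/
noncomputable def additiveE (x : ℝ) : ℂ :=
  Complex.exp (2 * (Real.pi : ℂ) * Complex.I * (x : ℂ))

/-! Choose `k` with `Q ^ k ≤ |A| < Q ^ (k + 1)`; then `5 ≤ k ≤ U`. Differentiating the phase `k ≥ 3`
times kills `A x² + B x`, and for large `x` the rest is governed by `A x⁻²`. On `x ≍ Q` the `k`-th
derivative thus has constant sign and size `μ ≍ |A| / Q ^ (k + 2)`, between constant multiples of
`Q⁻²` and `Q⁻¹`.

This is the range of the van der Corput derivative test of order `k = j + 1`: difference `j` times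
by `van_der_corput`, then bound the resulting sums, whose derivative is small and slowly varying, by
`kuzmin_landau_weak`. With differencing length `H ≍ μ ^ (-1 / j)` this saves `Q ^ δ`, `δ = 1 / (j 2
^ j)`, which beats every power of `log Q`. Only finitely many `k` occur, so the constants can be
summed. -/

theorem additiveE_eq (x : ℝ) : additiveE x = Complex.exp (Complex.I * ((2 * Real.pi * x : ℝ) : ℂ)) := by
  unfold additiveE
  congr 1
  push_cast
  ring

theorem norm_additiveE (x : ℝ) : ‖additiveE x‖ = 1 := by
  rw [additiveE_eq, mul_comm]
  exact Complex.norm_exp_ofReal_mul_I _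

theorem additiveE_add (x y : ℝ) : additiveE (x + y) = additiveE x * additiveE y := by
  simp only [additiveE_eq, ← Complex.exp_add]
  congr 1
  push_cast
  ring

theorem conj_additiveE (x : ℝ) : (starRingEnd ℂ) (additiveE x) = additiveE (-x) := by
  simp only [additiveE_eq, ← Complex.exp_conj]
  congr 1
  rw [map_mul, Complex.conj_I, Complex.conj_ofReal]
  push_cast
  ring

theorem norm_one_sub_additiveE_ge {d : ℝ} (h0 : 0 ≤ d) (h1 : d ≤ 1 / 2) :
    4 * d ≤ ‖1 - additiveE d‖ := by
  rw [norm_sub_rev, additiveE_eq, Complex.norm_exp_I_mul_ofReal_sub_one]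
  have hpi := Real.pi_pos
  have hs := Real.mul_le_sin (x := Real.pi * d) (by positivity) (by nlinarith)
  have he : 2 / Real.pi * (Real.pi * d) = 2 * d := by field_simp
  rw [he] at hs
  rw [show 2 * Real.pi * d / 2 = Real.pi * d by ring, Real.norm_eq_abs]
  refine le_trans ?_ (le_abs_self _)
  linarith

theorem norm_additiveE_sub_le (x y : ℝ) : ‖additiveE x - additiveE y‖ ≤ 2 * Real.pi * |x - y| := by
  have h : additiveE x - additiveE y = additiveE y * (additiveE (x - y) - 1) := by
    rw [mul_sub, ← additiveE_add, mul_one]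
    congr 2
    ring
  rw [h, norm_mul, norm_additiveE, one_mul, additiveE_eq]
  refine (Real.norm_exp_I_mul_ofReal_sub_one_le).trans ?_
  rw [Real.norm_eq_abs, abs_mul, abs_of_pos (by positivity : (0 : ℝ) < 2 * Real.pi)]

/-! ### Sums with small, slowly varying increments -/

/-- The weak form of the Kuzmin-Landau inequality: the increments `u (n + 1) - u n` lie in
`[μ, 1/2]` and vary by at most `δ` at each step. -/
theorem kuzmin_landau_weak (u : ℕ → ℝ) {μ δ : ℝ} (hμ : 0 < μ) (N : ℕ)
    (h1 : ∀ n ≤ N, μ ≤ u (n + 1) - u n) (h2 : ∀ n ≤ N, u (n + 1) - u n ≤ 1 / 2)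
    (h3 : ∀ n < N, |(u (n + 2) - u (n + 1)) - (u (n + 1) - u n)| ≤ δ) :
    ‖∑ n ∈ Finset.range (N + 2), additiveE (u n)‖ ≤ 1 / (2 * μ) + N * (δ / (2 * μ ^ 2)) + 1 := by
  -- Summation by parts: `e(u n) = c n * (e(u n) - e(u (n + 1)))`, so only the size and variation of
  -- `c` matter.
  set c : ℕ → ℂ := fun n => (1 - additiveE (u (n + 1) - u n))⁻¹ with hc
  have hlow : ∀ n ≤ N, 4 * μ ≤ ‖1 - additiveE (u (n + 1) - u n)‖ := fun n hn =>
    le_trans (by linarith [h1 n hn])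
      (norm_one_sub_additiveE_ge (hμ.le.trans (h1 n hn)) (h2 n hn))
  have hne : ∀ n ≤ N, 1 - additiveE (u (n + 1) - u n) ≠ 0 := fun n hn =>
    norm_pos_iff.mp (lt_of_lt_of_le (by linarith) (hlow n hn))
  have hcn : ∀ n ≤ N, ‖c n‖ ≤ 1 / (4 * μ) := by
    intro n hn
    rw [hc, norm_inv, ← one_div]
    exact one_div_le_one_div_of_le (by linarith) (hlow n hn)
  have hv : ∀ n ≤ N, additiveE (u n) + c n * additiveE (u (n + 1)) = c n * additiveE (u n) := by
    intro n hn
    have : additiveE (u (n + 1)) = additiveE (u (n + 1) - u n) * additiveE (u n) := by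
      rw [← additiveE_add]; congr 1; ring
    rw [this, hc]
    have := hne n hn
    field_simp
    ring
  have hcd : ∀ n < N, ‖c (n + 1) - c n‖ ≤ δ / (2 * μ ^ 2) := by
    intro n hn
    have e : c (n + 1) - c n = (additiveE (u (n + 1 + 1) - u (n + 1)) - additiveE (u (n + 1) - u n))
        * c (n + 1) * c n := by
      have a1 := hne n hn.le
      have a2 := hne (n + 1) hn
      simp only [hc]
      field_simp
      ring
    rw [e, norm_mul, norm_mul]
    have b1 := norm_additiveE_sub_le (u (n + 1 + 1) - u (n + 1)) (u (n + 1) - u n)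
    have b2 := h3 n hn
    have b3 : ‖additiveE (u (n + 1 + 1) - u (n + 1)) - additiveE (u (n + 1) - u n)‖ ≤ 8 * δ := by
      refine b1.trans ?_
      have := Real.pi_le_four
      have := Real.pi_pos
      have h0 := abs_nonneg (u (n + 2) - u (n + 1) - (u (n + 1) - u n))
      calc 2 * Real.pi * |u (n + 1 + 1) - u (n + 1) - (u (n + 1) - u n)|
          ≤ 8 * |u (n + 2) - u (n + 1) - (u (n + 1) - u n)| := by gcongr; linarith
        _ ≤ 8 * δ := by linarith
    have hδ : 0 ≤ δ := (abs_nonneg _).trans b2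
    calc _ ≤ 8 * δ * (1 / (4 * μ)) * (1 / (4 * μ)) := by
          gcongr
          · exact hcn _ hn
          · exact hcn _ hn.le
      _ = δ / (2 * μ ^ 2) := by field_simp; ring
  -- With the boundary term kept on the left, each step of the induction adds only `(c (m + 1) - c
  -- m) * e(u (m + 1))`.
  have key : ∀ m ≤ N, ‖∑ n ∈ Finset.range (m + 1), additiveE (u n) + c m * additiveE (u (m + 1))‖
      ≤ 1 / (4 * μ) + m * (δ / (2 * μ ^ 2)) := by
    intro m
    induction m with
    | zero =>
      intro h
      simp only [zero_add, Finset.range_one, Finset.sum_singleton]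
      rw [hv 0 h, norm_mul, norm_additiveE]
      simpa using hcn 0 h
    | succ m ih =>
      intro h
      have e : ∑ n ∈ Finset.range (m + 1 + 1), additiveE (u n)
          + c (m + 1) * additiveE (u (m + 1 + 1))
          = (∑ n ∈ Finset.range (m + 1), additiveE (u n) + c m * additiveE (u (m + 1)))
            + (c (m + 1) - c m) * additiveE (u (m + 1)) := by
        rw [Finset.sum_range_succ, add_assoc, hv (m + 1) h]
        ring
      rw [e]
      refine (norm_add_le _ _).trans ?_
      rw [norm_mul, norm_additiveE, mul_one]
      have := ih (by omega)
      have := hcd m (by omega)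
      push_cast
      linarith
  have e : ∑ n ∈ Finset.range (N + 2), additiveE (u n)
      = (∑ n ∈ Finset.range (N + 1), additiveE (u n) + c N * additiveE (u (N + 1)))
        - c N * additiveE (u (N + 1)) + additiveE (u (N + 1)) := by
    rw [Finset.sum_range_succ]
    ring
  rw [e]
  refine (norm_add_le _ _).trans ?_
  refine (add_le_add_left (norm_sub_le _ _) _).trans ?_
  rw [norm_mul, norm_additiveE, mul_one]
  have := key N le_rfl
  have := hcn N le_rfl
  have : 1 / (2 * μ) = 1 / (4 * μ) + 1 / (4 * μ) := by field_simp; norm_num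
  linarith

/-! ### Van der Corput differencing -/

/-- Van der Corput's inequality. -/
theorem van_der_corput (z : ℤ → ℂ) (hz : ∀ n, ‖z n‖ ≤ 1) (a b : ℤ) (H : ℕ) (hH : 0 < H) (X : ℝ)
    (hX : ((Finset.Icc a b).card : ℝ) ≤ X) (hHX : (H : ℝ) ≤ X) :
    ‖∑ n ∈ Finset.Icc a b, z n‖ ^ 2 ≤ 2 * X / H * (X + 2 * ∑ d ∈ Finset.Icc 1 H,
      ‖∑ n ∈ Finset.Icc a (b - d), z (n + d) * (starRingEnd ℂ) (z n)‖) := by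
  set w : ℤ → ℂ := fun n => if n ∈ Finset.Icc a b then z n else 0 with hw
  have hw0 : ∀ n, n ∉ Finset.Icc a b → w n = 0 := fun n hn => by simp only [hw, if_neg hn]
  -- `T` contains every `m` for which some `m + h` with `0 ≤ h < H` lies in `[a, b]`. Averaging over
  -- these shifts and applying Cauchy-Schwarz over `T` yields the correlations `R`.
  set T : Finset ℤ := Finset.Ico (a - H) (b + 1) with hT
  set S := ∑ n ∈ Finset.Icc a b, z n with hS
  set R : ℤ → ℂ := fun d => ∑ n ∈ Finset.Icc a b, w (n + d) * (starRingEnd ℂ) (w n) with hR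
  -- shifted correlation sums do not depend on the common shift
  have shift : ∀ (g : ℤ → ℂ), (∀ n, n ∉ Finset.Icc a b → g n = 0) → ∀ h ∈ Finset.range H,
      ∑ m ∈ T, g (m + h) = ∑ n ∈ Finset.Icc a b, g n := by
    intro g hg h hh
    rw [Finset.mem_range] at hh
    symm
    refine Eq.trans ?_ (Finset.sum_map T (addRightEmbedding (h : ℤ)) g)
    refine Finset.sum_subset ?_ (fun n _ hn => hg n hn)
    intro n hn
    simp only [Finset.mem_Icc, hT, Finset.mem_map, Finset.mem_Ico, addRightEmbedding_apply] at hn ⊢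
    exact ⟨n - h, by omega, by omega⟩
  have hSw : S = ∑ n ∈ Finset.Icc a b, w n :=
    Finset.sum_congr rfl fun n hn => by simp only [hw, if_pos hn]
  have e1 : (H : ℂ) * S = ∑ m ∈ T, ∑ h ∈ Finset.range H, w (m + h) := by
    rw [Finset.sum_comm, Finset.sum_congr rfl (shift w hw0), Finset.sum_const, Finset.card_range,
      nsmul_eq_mul, hSw]
  have e2 : (∑ m ∈ T, ‖∑ h ∈ Finset.range H, w (m + h)‖ ^ 2 : ℝ)
      ≤ ∑ h ∈ Finset.range H, ∑ h' ∈ Finset.range H, ‖R ((h : ℤ) - h')‖ := by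
    have e3 : ((∑ m ∈ T, ‖∑ h ∈ Finset.range H, w (m + h)‖ ^ 2 : ℝ) : ℂ)
        = ∑ h ∈ Finset.range H, ∑ h' ∈ Finset.range H, R ((h : ℤ) - h') := by
      push_cast
      have : ∀ m ∈ T, (‖∑ h ∈ Finset.range H, w (m + h)‖ : ℂ) ^ 2 =
          ∑ h ∈ Finset.range H, ∑ h' ∈ Finset.range H, w (m + h) * (starRingEnd ℂ) (w (m + h')) := by
        intro m _
        rw [← Complex.mul_conj', map_sum, Finset.sum_mul_sum]
      rw [Finset.sum_congr rfl this, Finset.sum_comm]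
      refine Finset.sum_congr rfl fun h _ => ?_
      rw [Finset.sum_comm]
      refine Finset.sum_congr rfl fun h' hh' => ?_
      refine Eq.trans ?_
        (shift (fun n => w (n + ((h : ℤ) - h')) * (starRingEnd ℂ) (w n)) ?_ h' hh')
      · refine Finset.sum_congr rfl fun m _ => ?_
        congr 2
        ring
      · intro n hn
        simp [hw0 n hn]
    have e4 := congrArg (fun x : ℂ => ‖x‖) e3
    simp only [Complex.norm_real] at e4
    rw [Real.norm_of_nonneg (by positivity)] at e4
    rw [e4]
    exact (norm_sum_le _ _).trans (Finset.sum_le_sum fun h _ => norm_sum_le _ _)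
  have hcard0 : ((b + 1 - a).toNat : ℝ) ≤ X := by simpa using hX
  have hR0 : ‖R 0‖ ≤ X := by
    refine (norm_sum_le _ _).trans (le_trans ?_ hX)
    refine (Finset.sum_le_card_nsmul _ _ 1 fun n hn => ?_).trans (by simp)
    simp only [add_zero, hw, if_pos hn, norm_mul, RCLike.norm_conj]
    exact mul_le_one₀ (hz n) (norm_nonneg _) (hz n)
  have hRd : ∀ d : ℕ, R d = ∑ n ∈ Finset.Icc a (b - d), z (n + d) * (starRingEnd ℂ) (z n) := by
    intro d
    symm
    rw [hR]
    refine (Finset.sum_congr rfl fun n hn => ?_).trans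
      (Finset.sum_subset (f := fun n => w (n + d) * (starRingEnd ℂ) (w n)) ?_ ?_)
    · rw [Finset.mem_Icc] at hn
      simp only [hw]
      rw [if_pos (Finset.mem_Icc.mpr (by omega)), if_pos (Finset.mem_Icc.mpr (by omega))]
    · intro n hn
      rw [Finset.mem_Icc] at hn ⊢
      omega
    · intro n hn hn'
      rw [Finset.mem_Icc] at hn hn'
      rw [hw0 (n + d) (by rw [Finset.mem_Icc]; omega), zero_mul]
  have hRneg : ∀ d : ℕ, ‖R (-d)‖ = ‖R d‖ := by
    intro d
    rw [hRd, hR, ← RCLike.norm_conj (∑ n ∈ Finset.Icc a (b - d), _), map_sum]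
    congr 1
    symm
    refine (Finset.sum_congr rfl fun n hn => ?_).trans
      ((Finset.sum_map (Finset.Icc a (b - d)) (addRightEmbedding (d : ℤ))
        (fun n => w (n + -d) * (starRingEnd ℂ) (w n))).symm.trans (Finset.sum_subset ?_ ?_))
    · rw [Finset.mem_Icc] at hn
      simp only [addRightEmbedding_apply, add_neg_cancel_right, map_mul, Complex.conj_conj, hw]
      rw [if_pos (Finset.mem_Icc.mpr (by omega)), if_pos (Finset.mem_Icc.mpr (by omega)), mul_comm]
    · intro n hn
      simp only [Finset.mem_map, Finset.mem_Icc, addRightEmbedding_apply] at hn ⊢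
      omega
    · intro n hn hn'
      simp only [Finset.mem_map, Finset.mem_Icc, addRightEmbedding_apply] at hn hn'
      have : n - d < a := by
        by_contra hcon
        exact hn' ⟨n - d, by omega, by omega⟩
      rw [hw0 (n + -d) (by rw [Finset.mem_Icc]; omega), zero_mul]
  set W := ∑ d ∈ Finset.Icc 1 H, ‖R d‖ with hW
  -- For fixed `h`, the differences `h - h'` are zero, positive or negative; each nonzero sign
  -- occurs at most once per size, whence `X + 2 * W`.
  have hrow : ∀ h ∈ Finset.range H, ∑ h' ∈ Finset.range H, ‖R ((h : ℤ) - h')‖ ≤ X + 2 * W := by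
    intro h hh
    rw [Finset.mem_range] at hh
    have hsplit : Finset.range H = Finset.range h ∪ ({h} ∪ Finset.Ico (h + 1) H) := by
      ext x; simp only [Finset.mem_range, Finset.mem_union, Finset.mem_singleton, Finset.mem_Ico]; omega
    have c1 : ∑ h' ∈ Finset.range h, ‖R ((h : ℤ) - h')‖ ≤ W := by
      rw [← Finset.sum_range_reflect]
      calc _ = ∑ d ∈ Finset.range h, ‖R ((d + 1 : ℕ) : ℤ)‖ := by
            refine Finset.sum_congr rfl fun d hd => ?_
            rw [Finset.mem_range] at hd
            congr 2
            omega
        _ = ∑ d ∈ Finset.Ico 1 (h + 1), ‖R (d : ℤ)‖ := by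
            rw [Finset.sum_Ico_eq_sum_range]
            refine Finset.sum_congr (by simp) fun d _ => ?_
            rw [add_comm 1 d]
        _ ≤ W := Finset.sum_le_sum_of_subset_of_nonneg (by
            intro x hx
            rw [Finset.mem_Ico] at hx; rw [Finset.mem_Icc]; omega) fun _ _ _ => norm_nonneg _
    have c2 : ∑ h' ∈ Finset.Ico (h + 1) H, ‖R ((h : ℤ) - h')‖ ≤ W := by
      rw [Finset.sum_Ico_eq_sum_range]
      calc _ = ∑ d ∈ Finset.range (H - (h + 1)), ‖R ((1 + d : ℕ) : ℤ)‖ := by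
            refine Finset.sum_congr rfl fun d hd => ?_
            rw [← hRneg]
            congr 2
            push_cast
            ring
        _ = ∑ d ∈ Finset.Ico 1 (H - h), ‖R (d : ℤ)‖ := by
            rw [Finset.sum_Ico_eq_sum_range]
            rfl
        _ ≤ W := Finset.sum_le_sum_of_subset_of_nonneg (by
            intro x hx
            rw [Finset.mem_Ico] at hx; rw [Finset.mem_Icc]; omega) fun _ _ _ => norm_nonneg _
    rw [hsplit, Finset.sum_union, Finset.sum_union, Finset.sum_singleton, sub_self]
    · linarith
    · simp
    · rw [Finset.disjoint_left]
      intro x hx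
      simp only [Finset.mem_range, Finset.mem_union, Finset.mem_singleton, Finset.mem_Ico] at hx ⊢
      omega
  have hWeq : W = ∑ d ∈ Finset.Icc 1 H,
      ‖∑ n ∈ Finset.Icc a (b - d), z (n + d) * (starRingEnd ℂ) (z n)‖ :=
    Finset.sum_congr rfl fun d _ => by rw [hRd]
  rw [← hWeq]
  have hX0 : 0 < X := lt_of_lt_of_le (by exact_mod_cast hH) hHX
  have hW0 : 0 ≤ W := Finset.sum_nonneg fun _ _ => norm_nonneg _
  have hcardT : (T.card : ℝ) ≤ 2 * X := by
    have : T.card ≤ (b + 1 - a).toNat + H := by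
      rw [hT, Int.card_Ico]; omega
    have : (T.card : ℝ) ≤ ((b + 1 - a).toNat : ℝ) + H := by exact_mod_cast this
    linarith
  have main : ((H : ℝ) * ‖S‖) ^ 2 ≤ 2 * X * (H * (X + 2 * W)) := by
    have f1 : (H : ℝ) * ‖S‖ ≤ ∑ m ∈ T, ‖∑ h ∈ Finset.range H, w (m + h)‖ := by
      have : (H : ℝ) * ‖S‖ = ‖(H : ℂ) * S‖ := by simp
      rw [this, e1]
      exact norm_sum_le _ _
    calc ((H : ℝ) * ‖S‖) ^ 2 ≤ (∑ m ∈ T, ‖∑ h ∈ Finset.range H, w (m + h)‖) ^ 2 := by gcongr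
      _ ≤ T.card * ∑ m ∈ T, ‖∑ h ∈ Finset.range H, w (m + h)‖ ^ 2 := sq_sum_le_card_mul_sum_sq
      _ ≤ 2 * X * (H * (X + 2 * W)) := by
          gcongr
          refine e2.trans ((Finset.sum_le_card_nsmul _ _ _ hrow).trans ?_)
          rw [Finset.card_range, nsmul_eq_mul]
  have hH' : (0 : ℝ) < H := by exact_mod_cast hH
  rw [div_mul_eq_mul_div, le_div_iff₀ hH']
  have : (H : ℝ) * (‖S‖ ^ 2 * H) ≤ H * (2 * X * (X + 2 * W)) := by nlinarith
  exact le_of_mul_le_mul_left this hH'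

/-! ### From increments to derivatives -/

theorem exists_sub_eq_mul_deriv {g g' : ℝ → ℝ} {a b x h : ℝ}
    (hg : ∀ y ∈ Set.Icc a b, HasDerivAt g (g' y) y) (hh : 0 < h) (hx : a ≤ x) (hxh : x + h ≤ b) :
    ∃ y ∈ Set.Icc a b, g (x + h) - g x = h * g' y := by
  have hsub : ∀ y ∈ Set.Icc x (x + h), y ∈ Set.Icc a b := fun y hy =>
    ⟨hx.trans hy.1, hy.2.trans hxh⟩
  obtain ⟨y, hy, e⟩ := exists_hasDerivAt_eq_slope g g' (by linarith : x < x + h)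
    (fun y hy => (hg y (hsub y hy)).continuousAt.continuousWithinAt)
    (fun y hy => hg y (hsub y (Set.Ioo_subset_Icc_self hy)))
  refine ⟨y, hsub y (Set.Ioo_subset_Icc_self hy), ?_⟩
  rw [e, add_sub_cancel_left]
  field_simp

/-- By the mean value theorem the increments lie in `[μ, c * μ]`, below `1 / 2` by `hsmall`. The
bound `c * μ / X` on `F 2` keeps their total variation over at most `X` steps at `O(μ)`, so
summation by parts costs only `O(1 / μ)`. -/
theorem norm_sum_additiveE_le_of_deriv {c X μ : ℝ} (hc : 1 ≤ c) (F : ℕ → ℝ → ℝ) (a b : ℤ)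
    (hX0 : 0 < X) (hX : ((Finset.Icc a b).card : ℝ) ≤ X) (hμ : 0 < μ) (hsmall : 2 * c * μ ≤ 1)
    (hF : ∀ i ≤ 1, ∀ x ∈ Set.Icc (a : ℝ) b, HasDerivAt (F i) (F (i + 1) x) x)
    (h1 : ∀ x ∈ Set.Icc (a : ℝ) b, μ ≤ F 1 x) (h2 : ∀ x ∈ Set.Icc (a : ℝ) b, F 1 x ≤ c * μ)
    (h3 : ∀ x ∈ Set.Icc (a : ℝ) b, |F 2 x| ≤ c * μ / X) :
    ‖∑ n ∈ Finset.Icc a b, additiveE (F 0 n)‖ ≤ 2 * c / μ := by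
  have hcμ : 1 ≤ 1 / (2 * μ) := by
    rw [le_div_iff₀ (by positivity)]
    nlinarith
  -- At most one term here; `kuzmin_landau_weak` needs at least two.
  rcases le_or_gt b a with hab | hab
  · have hcard : (Finset.Icc a b).card ≤ 1 := by
      rw [Int.card_Icc]
      omega
    have hcard' : ((Finset.Icc a b).card : ℝ) ≤ 1 := by exact_mod_cast hcard
    have b1 : ‖∑ n ∈ Finset.Icc a b, additiveE (F 0 n)‖ ≤ 1 := by
      refine (norm_sum_le _ _).trans ?_
      simpa [norm_additiveE] using hcard'
    have b2 : 1 / (2 * μ) ≤ 2 * c / μ := by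
      rw [div_le_div_iff₀ (by positivity) (by positivity)]
      nlinarith
    linarith
  obtain ⟨N, rfl⟩ : ∃ N : ℕ, b = a + (N + 1) := ⟨(b - a - 1).toNat, by omega⟩
  have hcard : (N : ℝ) ≤ X := by
    refine le_trans ?_ hX
    rw [Int.card_Icc]
    exact_mod_cast (by omega : N ≤ (a + (N + 1 : ℤ) + 1 - a).toNat)
  set u : ℕ → ℝ := fun n => F 0 ((a : ℝ) + n) with hu
  have hsum : ∑ n ∈ Finset.Icc a (a + (N + 1 : ℤ)), additiveE (F 0 n)
      = ∑ n ∈ Finset.range (N + 2), additiveE (u n) := by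
    symm
    refine Finset.sum_bij (fun n _ => a + (n : ℤ)) ?_ ?_ ?_ ?_
    · intro n hn
      rw [Finset.mem_range] at hn
      rw [Finset.mem_Icc]
      omega
    · intro n _ m _ h
      omega
    · intro m hm
      rw [Finset.mem_Icc] at hm
      exact ⟨(m - a).toNat, by rw [Finset.mem_range]; omega, by omega⟩
    · intro n _
      simp [hu]
  push_cast at hF h1 h2 h3
  have hdiff : ∀ n ≤ N, ∃ y ∈ Set.Icc (a : ℝ) (a + (N + 1)), u (n + 1) - u n = F 1 y := by
    intro n hn
    have hn' : (n : ℝ) ≤ N := by exact_mod_cast hn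
    obtain ⟨y, hy, e⟩ := exists_sub_eq_mul_deriv (x := (a : ℝ) + n) (hF 0 (by norm_num)) one_pos
      (by linarith [Nat.cast_nonneg (α := ℝ) n]) (by linarith)
    refine ⟨y, hy, ?_⟩
    rw [one_mul] at e
    rw [← e, hu]
    push_cast
    rw [add_assoc]
  have hmain := kuzmin_landau_weak u (δ := c * μ / X) hμ N ?_ ?_ ?_
  · rw [hsum]
    refine hmain.trans ?_
    have q : (N : ℝ) * (c * μ / X / (2 * μ ^ 2)) ≤ c / (2 * μ) := by
      calc (N : ℝ) * (c * μ / X / (2 * μ ^ 2)) ≤ X * (c * μ / X / (2 * μ ^ 2)) := by gcongr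
        _ = c / (2 * μ) := by field_simp
    have q2 : 2 * c / μ = 4 * (c * (1 / (2 * μ))) := by field_simp; norm_num
    have q3 : c / (2 * μ) = c * (1 / (2 * μ)) := by ring
    rw [q2]
    rw [q3] at q
    nlinarith
  · intro n hn
    obtain ⟨y, hy, e⟩ := hdiff n hn
    rw [e]
    exact h1 y hy
  · intro n hn
    obtain ⟨y, hy, e⟩ := hdiff n hn
    rw [e]
    linarith [h2 y hy]
  · intro n hn
    have hn' : (n : ℝ) + 1 ≤ N := by exact_mod_cast hn
    have hn0 : (0 : ℝ) ≤ n := Nat.cast_nonneg n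
    obtain ⟨y, hy, e⟩ := exists_sub_eq_mul_deriv (g := fun x => F 0 (x + 1) - F 0 x)
      (g' := fun x => F 1 (x + 1) - F 1 x) (a := a) (b := a + N) (x := (a : ℝ) + n)
      (fun y hy => (HasDerivAt.comp_add_const y 1 (hF 0 (by norm_num) (y + 1)
        ⟨by linarith [hy.1], by linarith [hy.2]⟩)).sub
        (hF 0 (by norm_num) y ⟨by linarith [hy.1], by linarith [hy.2]⟩)) one_pos
      (by linarith) (by linarith)
    obtain ⟨y', hy', e'⟩ := exists_sub_eq_mul_deriv (x := y) (hF 1 le_rfl) one_pos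
      hy.1 (by linarith [hy.2])
    have : u (n + 2) - u (n + 1) - (u (n + 1) - u n) = F 2 y' := by
      rw [one_mul] at e e'
      rw [← e', ← e, hu]
      push_cast
      ring_nf
    rw [this]
    exact h3 y' hy'

/-! ### Iterated differencing and the derivative test -/

theorem pow_le_of_sq_le_add_mean {s H m C E : ℝ} {p : ℕ} (hH : 1 ≤ H) (hs : 0 ≤ s ^ 2)
    (hsq : s ^ 2 ≤ 4 * (1 / H + m)) (hm : 0 ≤ m) (hp : p ≠ 0) (hE : 0 ≤ E)
    (hmean : m ^ p ≤ C * (1 / H + E)) : (s ^ 2) ^ p ≤ 8 ^ p * (1 + C) * (1 / H + E) := by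
  have hH0 : 0 < H := by linarith
  have hHp : (1 / H) ^ p ≤ 1 / H :=
    pow_le_of_le_one (by positivity) (by rw [div_le_one hH0]; exact hH) hp
  calc (s ^ 2) ^ p ≤ (4 * (1 / H + m)) ^ p := pow_le_pow_left₀ hs hsq p
    _ = 4 ^ p * (1 / H + m) ^ p := mul_pow _ _ _
    _ ≤ 4 ^ p * (2 ^ (p - 1) * ((1 / H) ^ p + m ^ p)) := by
        gcongr
        exact add_pow_le (by positivity) hm p
    _ ≤ 4 ^ p * (2 ^ p * (1 / H + C * (1 / H + E))) := by
        gcongr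
        · norm_num
        · omega
    _ ≤ 4 ^ p * (2 ^ p * ((1 + C) * (1 / H + E))) := by
        gcongr
        rw [add_mul, one_mul]
        linarith
    _ = _ := by
        rw [show (8 : ℝ) = 4 * 2 by norm_num, mul_pow]
        ring

/-- Differencing by `d` turns the derivative of order `i` into `d * F (i + 1) y`, so `j + 1`
differencings for `μ` reduce to `j` for `d * μ`. The resulting factor `1 / d`, averaged over `d ≤
H`, contributes `L / H`. The power `2 ^ j` avoids roots, and convexity moves it inside the average.
The same `H` serves at every stage. -/
theorem exists_differencing_bound (c : ℝ) (hc : 1 ≤ c) (j : ℕ) : ∃ C : ℝ, 0 < C ∧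
    ∀ (F : ℕ → ℝ → ℝ) (a b : ℤ) (H : ℕ) (X L μ : ℝ), 0 < H → (H : ℝ) ≤ X →
      ((Finset.Icc a b).card : ℝ) ≤ X → 1 ≤ L → ∑ h ∈ Finset.Icc 1 H, 1 / (h : ℝ) ≤ L →
      0 < μ → 2 * c * μ * (H : ℝ) ^ j ≤ 1 →
      (∀ i ≤ j + 1, ∀ x ∈ Set.Icc (a : ℝ) b, HasDerivAt (F i) (F (i + 1) x) x) →
      (∀ x ∈ Set.Icc (a : ℝ) b, μ ≤ F (j + 1) x) →
      (∀ x ∈ Set.Icc (a : ℝ) b, F (j + 1) x ≤ c * μ) →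
      (∀ x ∈ Set.Icc (a : ℝ) b, |F (j + 2) x| ≤ c * μ / X) →
      (‖∑ n ∈ Finset.Icc a b, additiveE (F 0 n)‖ / X) ^ (2 ^ j)
        ≤ C * (1 / H + L ^ j / (X * μ * (H : ℝ) ^ j)) := by
  induction j with
  | zero =>
    refine ⟨2 * c, by linarith, ?_⟩
    intro F a b H X L μ hH hHX hX hL hsumL hμ hsmall hF h1 h2 h3
    have hH' : (0 : ℝ) < H := by exact_mod_cast hH
    have hX0 : 0 < X := hH'.trans_le hHX
    have := norm_sum_additiveE_le_of_deriv hc F a b hX0 hX hμ (by simpa using hsmall) hF h1 h2 h3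
    simp only [pow_zero, pow_one, mul_one]
    rw [div_le_iff₀ hX0]
    refine this.trans ?_
    have e : 2 * c * (1 / H + 1 / (X * μ)) * X = 2 * c / μ + 2 * c * X / H := by
      field_simp
      ring
    rw [e]
    have : 0 ≤ 2 * c * X / H := by positivity
    linarith
  | succ j ih =>
    obtain ⟨C, hC, ih⟩ := ih
    set p := 2 ^ j with hp
    refine ⟨8 ^ p * (1 + C), by positivity, ?_⟩
    intro F a b H X L μ hH hHX hX hL hsumL hμ hsmall hF h1 h2 h3
    have hH' : (0 : ℝ) < H := by exact_mod_cast hH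
    have hH1 : (1 : ℝ) ≤ H := by exact_mod_cast hH
    have hX0 : 0 < X := hH'.trans_le hHX
    set s := ‖∑ n ∈ Finset.Icc a b, additiveE (F 0 n)‖ / X with hs
    set t : ℕ → ℝ := fun d => ‖∑ n ∈ Finset.Icc a (b - (d : ℤ)),
      additiveE (F 0 ((n : ℝ) + d) - F 0 n)‖ / X with ht
    have ht0 : ∀ d, 0 ≤ t d := fun d => by positivity
    have hvdc := van_der_corput (fun n : ℤ => additiveE (F 0 n))
      (fun n => (norm_additiveE _).le) a b H hH X hX hHX
    have hsq : s ^ 2 ≤ 4 * (1 / H + ∑ d ∈ Finset.Icc 1 H, 1 / (H : ℝ) * t d) := by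
      have e : ∑ d ∈ Finset.Icc 1 H, ‖∑ n ∈ Finset.Icc a (b - (d : ℤ)),
          additiveE (F 0 ((n + d : ℤ) : ℝ)) * (starRingEnd ℂ) (additiveE (F 0 n))‖
          = X * ∑ d ∈ Finset.Icc 1 H, t d := by
        rw [Finset.mul_sum]
        refine Finset.sum_congr rfl fun d _ => ?_
        simp only [ht]
        rw [mul_div_cancel₀ _ hX0.ne']
        congr 1
        refine Finset.sum_congr rfl fun n _ => ?_
        rw [conj_additiveE, ← additiveE_add]
        push_cast
        rfl
      rw [e] at hvdc
      rw [← Finset.mul_sum, hs, div_pow, div_le_iff₀ (by positivity)]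
      refine hvdc.trans ?_
      have : 2 * X / H * (X + 2 * (X * ∑ d ∈ Finset.Icc 1 H, t d))
          = (2 * (1 / H) + 4 * (1 / H * ∑ d ∈ Finset.Icc 1 H, t d)) * X ^ 2 := by
        field_simp
        ring
      rw [this]
      gcongr
      have : 0 ≤ 1 / (H : ℝ) := by positivity
      linarith
    have hterm : ∀ d ∈ Finset.Icc 1 H,
        t d ^ p ≤ C * (1 / H + L ^ j / (X * μ * (H : ℝ) ^ j) * (1 / d)) := by
      intro d hd
      rw [Finset.mem_Icc] at hd
      have hd0 : (0 : ℝ) < d := by exact_mod_cast hd.1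
      have hdH : (d : ℝ) ≤ H := by exact_mod_cast hd.2
      have hmvt : ∀ i ≤ j + 2, ∀ x ∈ Set.Icc (a : ℝ) ((b - d : ℤ) : ℝ),
          ∃ y ∈ Set.Icc (a : ℝ) b, F i (x + d) - F i x = d * F (i + 1) y := by
        intro i hi x hx
        push_cast at hx
        exact exists_sub_eq_mul_deriv (hF i hi) hd0 hx.1 (by linarith [hx.2])
      have key := ih (fun i x => F i (x + d) - F i x) a (b - d) H X L (d * μ) hH hHX ?_ hL hsumL
        (by positivity) ?_ ?_ ?_ ?_ ?_
      · refine key.trans (le_of_eq ?_)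
        congr 2
        field_simp
      · refine le_trans ?_ hX
        exact_mod_cast Finset.card_le_card (Finset.Icc_subset_Icc_right (by omega))
      · refine le_trans ?_ hsmall
        have : 2 * c * μ * (H : ℝ) ^ (j + 1) = 2 * c * (H * μ) * (H : ℝ) ^ j := by ring
        rw [this]
        gcongr
      · intro i hi x hx
        push_cast at hx
        exact (HasDerivAt.comp_add_const x d (hF i (by omega) (x + d)
          ⟨by linarith [hx.1], by linarith [hx.2]⟩)).sub
          (hF i (by omega) x ⟨hx.1, by linarith [hx.2]⟩)
      · intro x hx
        obtain ⟨y, hy, e⟩ := hmvt (j + 1) (by omega) x hx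
        simp only [e]
        gcongr
        exact h1 y hy
      · intro x hx
        obtain ⟨y, hy, e⟩ := hmvt (j + 1) (by omega) x hx
        simp only [e]
        rw [mul_left_comm]
        gcongr
        exact h2 y hy
      · intro x hx
        obtain ⟨y, hy, e⟩ := hmvt (j + 2) le_rfl x hx
        simp only [e]
        rw [abs_mul, abs_of_pos hd0, mul_left_comm, mul_div_assoc]
        gcongr
        exact h3 y hy
    have hp0 : p ≠ 0 := by positivity
    have hone : ∑ _d ∈ Finset.Icc 1 H, 1 / (H : ℝ) = 1 := by
      rw [Finset.sum_const, Nat.card_Icc, Nat.add_sub_cancel, nsmul_eq_mul]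
      field_simp
    have hmean : (∑ d ∈ Finset.Icc 1 H, 1 / (H : ℝ) * t d) ^ p
        ≤ C * (1 / H + L ^ (j + 1) / (X * μ * (H : ℝ) ^ (j + 1))) := by
      refine (Real.pow_arith_mean_le_arith_mean_pow _ _ _ (fun _ _ => by positivity) hone
        (fun d _ => ht0 d) p).trans ?_
      calc ∑ d ∈ Finset.Icc 1 H, 1 / (H : ℝ) * t d ^ p
          ≤ ∑ d ∈ Finset.Icc 1 H, 1 / (H : ℝ) *
              (C * (1 / H + L ^ j / (X * μ * (H : ℝ) ^ j) * (1 / d))) := by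
            gcongr with d hd
            exact hterm d hd
        _ = C * ((∑ _d ∈ Finset.Icc 1 H, 1 / (H : ℝ)) * (1 / H)
              + L ^ j / (X * μ * (H : ℝ) ^ j) * (1 / H) * ∑ d ∈ Finset.Icc 1 H, 1 / (d : ℝ)) := by
            rw [Finset.sum_mul, Finset.mul_sum, ← Finset.sum_add_distrib, Finset.mul_sum]
            refine Finset.sum_congr rfl fun d _ => ?_
            ring
        _ ≤ C * (1 * (1 / H) + L ^ j / (X * μ * (H : ℝ) ^ j) * (1 / H) * L) := by
            rw [hone]
            gcongr
        _ = _ := by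
            field_simp
            ring
    rw [pow_succ 2 j, mul_comm (2 ^ j) 2, pow_mul]
    exact pow_le_of_sq_le_add_mean hH1 (by positivity) hsq
      (Finset.sum_nonneg fun d _ => mul_nonneg (by positivity) (ht0 d)) hp0
      (by positivity) hmean

theorem sum_one_div_le_one_add_log (H : ℕ) :
    ∑ h ∈ Finset.Icc 1 H, 1 / (h : ℝ) ≤ 1 + Real.log H := by
  have h := harmonic_le_one_add_log H
  rw [harmonic_eq_sum_Icc] at h
  push_cast at h
  simpa using h

/-- The derivative test of order `j + 1`: the derivative of that order is positive, of size
comparable with `μ`, and varies slowly. -/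
theorem exists_derivative_test (c : ℝ) (hc : 1 ≤ c) (j : ℕ) (hj : j ≠ 0) : ∃ C : ℝ, 0 < C ∧
    ∀ (F : ℕ → ℝ → ℝ) (a b : ℤ) (X μ : ℝ), 1 ≤ X → ((Finset.Icc a b).card : ℝ) ≤ X → 0 < μ →
      2 * c * μ ≤ 1 → 1 / (2 * c * μ) ≤ X ^ j →
      (∀ i ≤ j + 1, ∀ x ∈ Set.Icc (a : ℝ) b, HasDerivAt (F i) (F (i + 1) x) x) →
      (∀ x ∈ Set.Icc (a : ℝ) b, μ ≤ F (j + 1) x) →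
      (∀ x ∈ Set.Icc (a : ℝ) b, F (j + 1) x ≤ c * μ) →
      (∀ x ∈ Set.Icc (a : ℝ) b, |F (j + 2) x| ≤ c * μ / X) →
      (‖∑ n ∈ Finset.Icc a b, additiveE (F 0 n)‖ / X) ^ (2 ^ j)
        ≤ C * (μ ^ (1 / (j : ℝ)) + X ^ (-(1 / 2) : ℝ)) := by
  obtain ⟨C, hC, hbound⟩ := exists_differencing_bound c hc j
  have hj0 : (0 : ℝ) < j := by exact_mod_cast Nat.pos_of_ne_zero hj
  refine ⟨C * (2 * (2 * c) ^ (1 / (j : ℝ)) + 2 * c * 2 ^ j * (1 + 2 * j) ^ j), by positivity, ?_⟩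
  intro F a b X μ hX1 hX hμ hsmall hlarge hF h1 h2 h3
  have hX0 : 0 < X := by linarith
  -- The largest length allowed by `2 * c * μ * H ^ j ≤ 1`. Its integer part makes `μ * H ^ j ≍ 1`,
  -- leaving only logarithms over `X` in the second error term.
  set r : ℝ := (1 / (2 * c * μ)) ^ (1 / (j : ℝ)) with hr
  have hrj : r ^ j = 1 / (2 * c * μ) := by
    rw [hr, one_div (j : ℝ), Real.rpow_inv_natCast_pow (by positivity) hj]
  have hr0 : 0 < r := by positivity
  have hr1 : 1 ≤ r := by
    apply Real.one_le_rpow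
    · rw [le_div_iff₀ (by positivity)]
      linarith
    · positivity
  have hrX : r ≤ X := by
    rw [← pow_le_pow_iff_left₀ hr0.le hX0.le hj, hrj]
    exact hlarge
  set H := ⌊r⌋₊ with hH
  have hHr : (H : ℝ) ≤ r := Nat.floor_le hr0.le
  have hHpos : 0 < H := Nat.floor_pos.mpr hr1
  have hH1 : (1 : ℝ) ≤ H := by exact_mod_cast hHpos
  have hH0 : (0 : ℝ) < H := by linarith
  have hrH : r ≤ 2 * H := by
    have := (Nat.lt_floor_add_one r).le
    linarith
  have hlog : 0 ≤ Real.log H := Real.log_nonneg hH1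
  refine (hbound F a b H X (1 + Real.log H) μ hHpos (hHr.trans hrX) hX (by linarith)
    (sum_one_div_le_one_add_log H) hμ ?_ hF h1 h2 h3).trans ?_
  · calc 2 * c * μ * (H : ℝ) ^ j ≤ 2 * c * μ * r ^ j := by gcongr
      _ = 1 := by rw [hrj]; field_simp
  have hA : 1 / (H : ℝ) ≤ 2 * (2 * c) ^ (1 / (j : ℝ)) * μ ^ (1 / (j : ℝ)) := by
    have e : r * ((2 * c) ^ (1 / (j : ℝ)) * μ ^ (1 / (j : ℝ))) = 1 := by
      rw [hr, ← Real.mul_rpow (by positivity) hμ.le, ← Real.mul_rpow (by positivity) (by positivity),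
        one_div_mul_cancel (by positivity), Real.one_rpow]
    rw [div_le_iff₀ hH0]
    have : 0 ≤ (2 * c) ^ (1 / (j : ℝ)) * μ ^ (1 / (j : ℝ)) := by positivity
    nlinarith
  -- Bounding the logarithm by `X ^ (1 / (2 * j))` makes its `j`-th power cost `X ^ (1 / 2)`.
  have hLj : (1 + Real.log H) ^ j ≤ (1 + 2 * j) ^ j * X ^ (1 / 2 : ℝ) := by
    have hε : 0 < 1 / (2 * (j : ℝ)) := by positivity
    have g1 : Real.log H ≤ 2 * j * X ^ (1 / (2 * (j : ℝ))) := by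
      have := Real.log_le_rpow_div hH0.le hε
      refine this.trans ?_
      rw [div_div_eq_mul_div, div_one, mul_comm]
      gcongr
      exact hHr.trans hrX
    have g2 : 1 ≤ X ^ (1 / (2 * (j : ℝ))) := Real.one_le_rpow hX1 hε.le
    calc (1 + Real.log H) ^ j ≤ ((1 + 2 * j) * X ^ (1 / (2 * (j : ℝ)))) ^ j := by
          gcongr
          linarith
      _ = _ := by
          rw [mul_pow, ← Real.rpow_mul_natCast hX0.le]
          congr 2
          field_simp
  have hden : 1 / (2 * c * 2 ^ j) ≤ μ * (H : ℝ) ^ j := by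
    have : r ^ j ≤ (2 * H) ^ j := by gcongr
    rw [hrj, mul_pow, div_le_iff₀ (by positivity)] at this
    rw [div_le_iff₀ (by positivity)]
    linarith
  have hB : (1 + Real.log H) ^ j / (X * μ * (H : ℝ) ^ j)
      ≤ 2 * c * 2 ^ j * (1 + 2 * j) ^ j * X ^ (-(1 / 2) : ℝ) := by
    have e : X ^ (-(1 / 2) : ℝ) = X ^ (1 / 2 : ℝ) / X := by
      rw [← Real.rpow_sub_one hX0.ne']
      norm_num
    calc (1 + Real.log H) ^ j / (X * μ * (H : ℝ) ^ j)
        ≤ ((1 + 2 * j) ^ j * X ^ (1 / 2 : ℝ)) / (X * (1 / (2 * c * 2 ^ j))) := by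
          rw [mul_assoc]
          gcongr
      _ = _ := by
          rw [e]
          field_simp
  have hp1 : 0 ≤ μ ^ (1 / (j : ℝ)) := by positivity
  have hp2 : 0 ≤ X ^ (-(1 / 2) : ℝ) := by positivity
  rw [mul_assoc C]
  refine mul_le_mul_of_nonneg_left ((add_le_add hA hB).trans ?_) hC.le
  have q1 : 0 ≤ 2 * (2 * c) ^ (1 / (j : ℝ)) := by positivity
  have q2 : 0 ≤ 2 * c * 2 ^ j * (1 + 2 * (j : ℝ)) ^ j := by positivity
  nlinarith [mul_nonneg q1 hp2, mul_nonneg q2 hp1]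

/-! ### Derivatives of the phase -/

open Nat in
/-- The `i`-th derivative of `A x⁻² + B x⁻³`. -/
noncomputable def negPowDeriv (A B : ℝ) (i : ℕ) (x : ℝ) : ℝ :=
  (-1) ^ i * (A * (i + 1)! / x ^ (i + 2) + B * ((i + 2)! / 2) / x ^ (i + 3))

/-- The `i`-th derivative of `A x² + B x`. -/
noncomputable def quadDeriv (A B : ℝ) : ℕ → ℝ → ℝ
  | 0 => fun x => A * x ^ 2 + B * x
  | 1 => fun x => 2 * A * x + B
  | 2 => fun _ => 2 * A
  | _ + 3 => fun _ => 0

/-- The `i`-th derivative of `A (x² + x⁻²) + B (x + x⁻³)`. -/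
noncomputable def phaseDeriv (A B : ℝ) (i : ℕ) (x : ℝ) : ℝ :=
  quadDeriv A B i x + negPowDeriv A B i x

theorem hasDerivAt_const_div_pow (a : ℝ) (m : ℕ) {x : ℝ} (hx : x ≠ 0) :
    HasDerivAt (fun y => a / y ^ m) (-(a * m / x ^ (m + 1))) x := by
  have h := (hasDerivAt_zpow (-(m : ℤ)) x (Or.inl hx)).const_mul a
  have e : (fun y : ℝ => a * y ^ (-(m : ℤ))) = fun y => a / y ^ m := by
    funext y
    rw [zpow_neg, zpow_natCast, div_eq_mul_inv]
  rw [e] at h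
  refine h.congr_deriv ?_
  rw [show -(m : ℤ) - 1 = -((m + 1 : ℕ) : ℤ) by push_cast; ring, zpow_neg, zpow_natCast]
  push_cast
  rw [div_eq_mul_inv]
  ring

theorem hasDerivAt_negPowDeriv (A B : ℝ) (i : ℕ) {x : ℝ} (hx : x ≠ 0) :
    HasDerivAt (negPowDeriv A B i) (negPowDeriv A B (i + 1) x) x := by
  have h := ((hasDerivAt_const_div_pow (A * (i + 1).factorial) (i + 2) hx).add
    (hasDerivAt_const_div_pow (B * ((i + 2).factorial / 2)) (i + 3) hx)).const_mul ((-1 : ℝ) ^ i)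
  refine h.congr_deriv ?_
  unfold negPowDeriv
  rw [Nat.factorial_succ (i + 1 + 1), Nat.factorial_succ (i + 1)]
  push_cast
  rw [show i + 1 + 2 = i + 3 by ring, show i + 1 + 3 = i + 4 by ring,
    show i + 2 + 1 = i + 3 by ring, show i + 3 + 1 = i + 4 by ring]
  ring

theorem hasDerivAt_quadDeriv (A B : ℝ) (i : ℕ) (x : ℝ) :
    HasDerivAt (quadDeriv A B i) (quadDeriv A B (i + 1) x) x := by
  match i with
  | 0 =>
    have h := (((hasDerivAt_id x).pow 2).const_mul A).add ((hasDerivAt_id x).const_mul B)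
    refine h.congr_deriv ?_
    simp [quadDeriv]
    ring
  | 1 =>
    have h := ((hasDerivAt_id x).const_mul (2 * A)).add_const B
    refine h.congr_deriv ?_
    simp [quadDeriv]
  | 2 => exact hasDerivAt_const x (2 * A)
  | _ + 3 => exact hasDerivAt_const x (0 : ℝ)

theorem hasDerivAt_phaseDeriv (A B : ℝ) (i : ℕ) {x : ℝ} (hx : x ≠ 0) :
    HasDerivAt (phaseDeriv A B i) (phaseDeriv A B (i + 1) x) x :=
  (hasDerivAt_quadDeriv A B i x).add (hasDerivAt_negPowDeriv A B i hx)

theorem phaseDeriv_zero (A B x : ℝ) :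
    phaseDeriv A B 0 x = A * (x ^ 2 + x ^ (-2 : ℤ)) + B * (x + x ^ (-3 : ℤ)) := by
  have e2 : x ^ (-2 : ℤ) = (x ^ 2)⁻¹ := by rw [zpow_neg]; norm_cast
  have e3 : x ^ (-3 : ℤ) = (x ^ 3)⁻¹ := by rw [zpow_neg]; norm_cast
  rw [e2, e3]
  simp [phaseDeriv, quadDeriv, negPowDeriv, Nat.factorial]
  ring

/-- For large `x` the term in `A` dominates a derivative of order at least three. -/
theorem phaseDeriv_mem_Icc {A B σ : ℝ} (hσ : |σ| = 1) (hA : σ * A = |A|) (hB : |B| ≤ |A|) {i : ℕ}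
    (hi : 3 ≤ i) {x : ℝ} (hx : (i : ℝ) + 2 ≤ x) :
    σ * (-1) ^ i * phaseDeriv A B i x ∈
      Set.Icc (1 / 2 * (|A| * (i + 1).factorial / x ^ (i + 2)))
        (3 / 2 * (|A| * (i + 1).factorial / x ^ (i + 2))) := by
  have hx0 : 0 < x := lt_of_lt_of_le (by positivity) hx
  obtain ⟨m, rfl⟩ : ∃ m, i = m + 3 := ⟨i - 3, by omega⟩
  set i := m + 3 with hi'
  set D := |A| * (i + 1).factorial / x ^ (i + 2) with hD
  have e : σ * (-1) ^ i * phaseDeriv A B i x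
      = D + σ * B * ((i + 2).factorial / 2) / x ^ (i + 3) := by
    have hq : quadDeriv A B i x = 0 := rfl
    have hs : ((-1 : ℝ) ^ i) * (-1) ^ i = 1 := by rw [← mul_pow]; norm_num
    unfold phaseDeriv negPowDeriv
    rw [hq, zero_add, hD, ← hA]
    linear_combination (σ * (A * (i + 1).factorial / x ^ (i + 2)
      + B * ((i + 2).factorial / 2) / x ^ (i + 3))) * hs
  -- The ratio of the `B` term to the `A` term is at most `(i + 2) / (2 * x) ≤ 1 / 2`.
  have hsmall : |σ * B * ((i + 2).factorial / 2) / x ^ (i + 3)| ≤ 1 / 2 * D := by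
    rw [abs_div, abs_mul, abs_mul, hσ, one_mul, abs_of_pos (by positivity : 0 < x ^ (i + 3)),
      abs_of_pos (by positivity : (0 : ℝ) < (i + 2).factorial / 2)]
    calc |B| * ((i + 2).factorial / 2) / x ^ (i + 3)
        ≤ |A| * ((i + 2).factorial / 2) / x ^ (i + 3) := by gcongr
      _ = 1 / 2 * (D * ((i + 2) / x)) := by
          rw [hD, Nat.factorial_succ (i + 1)]
          push_cast
          field_simp
          ring
      _ ≤ 1 / 2 * (D * 1) := by
          gcongr
          rw [div_le_one hx0]
          exact hx
      _ = 1 / 2 * D := by ring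
  rw [e]
  have := abs_le.mp hsmall
  constructor <;> linarith

/-! ### Power saving for one range of `|A|` -/

theorem norm_sum_additiveE_neg (s : Finset ℤ) (f : ℤ → ℝ) :
    ‖∑ n ∈ s, additiveE (-f n)‖ = ‖∑ n ∈ s, additiveE (f n)‖ := by
  simp only [← conj_additiveE, ← map_sum, RCLike.norm_conj]

theorem card_Icc_le_of_bounds {a b : ℤ} {y z : ℝ} (hy : 0 < y) (hz : 0 ≤ z) (ha : y ≤ a)
    (hb : (b : ℝ) ≤ z) : ((Finset.Icc a b).card : ℝ) ≤ z := by
  have ha' : 0 < a := by exact_mod_cast hy.trans_le ha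
  rw [Int.card_Icc]
  rcases le_or_gt 0 b with h | h
  · refine le_trans ?_ hb
    have : ((b + 1 - a).toNat : ℤ) ≤ b := by omega
    exact_mod_cast this
  · rw [show (b + 1 - a).toNat = 0 by omega]
    simpa using hz

theorem exists_power_saving_of_large (c₁ c₂ : ℝ) (hc₁ : 0 < c₁) (hc₂ : c₁ < c₂) (k : ℕ)
    (hk : 5 ≤ k) : ∃ K δ Q₀ : ℝ, 0 < K ∧ 0 < δ ∧ 1 ≤ Q₀ ∧ ∀ Q A B : ℝ, Q₀ ≤ Q → Q ^ k ≤ |A| →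
      |A| ≤ Q ^ (k + 1) → |B| ≤ |A| → ∀ a b : ℤ, c₁ * Q ≤ a → (b : ℝ) ≤ c₂ * Q →
        ‖∑ n ∈ Finset.Icc a b, additiveE (phaseDeriv A B 0 n)‖ ≤ K * (Q * Q ^ (-δ)) := by
  obtain ⟨j, rfl⟩ : ∃ j, k = j + 1 := ⟨k - 1, by omega⟩
  have hj : 4 ≤ j := by omega
  have hc₂0 : 0 < c₂ := hc₁.trans hc₂
  -- `κ * |A| / Q ^ (j + 3)` is half the leading term at `c₂ * Q`, and `ρ` is the ratio of its
  -- values at `c₁ * Q` and `c₂ * Q`. The second summand in `c` absorbs the factor `(j + 3) / x`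
  -- gained by the next derivative.
  set κ : ℝ := 1 / 2 * ((j + 2).factorial / c₂ ^ (j + 3)) with hκ
  have hκ0 : 0 < κ := by positivity
  set ρ : ℝ := (c₂ / c₁) ^ (j + 3) with hρ
  have hρ1 : 1 ≤ ρ := one_le_pow₀ (by rw [le_div_iff₀ hc₁]; linarith)
  set c : ℝ := 3 * ρ * (1 + (j + 3) * (c₂ + 1) / c₁) with hc
  have hcρ : 3 * ρ ≤ c := le_mul_of_one_le_right (by positivity)
    (le_add_of_nonneg_right (by positivity))
  have hcρ' : 3 * ρ * ((j + 3) * (c₂ + 1) / c₁) ≤ c := by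
    rw [hc]
    gcongr
    linarith
  have hc1 : 1 ≤ c := by linarith
  obtain ⟨C, hC, htest⟩ := exists_derivative_test c hc1 j (by omega)
  have hj0 : (0 : ℝ) < j := by exact_mod_cast (by omega : 0 < j)
  set C' : ℝ := C * (κ ^ (1 / (j : ℝ)) + 1) with hC'
  have hC'0 : 0 < C' := by positivity
  set K : ℝ := C' ^ (1 / ((2 ^ j : ℕ) : ℝ)) with hK
  set δ : ℝ := 1 / j * (1 / ((2 ^ j : ℕ) : ℝ)) with hδ
  -- The summands of the threshold ensure in turn `1 ≤ Q`, `x ≥ j + 4`, `2 * c * μ ≤ 1` and `1 / (2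
  -- * c * μ) ≤ X ^ j`.
  refine ⟨(c₂ + 1) * K, δ, 1 + (j + 4) / c₁ + 2 * c * κ + 1 / (2 * c * κ), by positivity,
    by positivity, ?_, ?_⟩
  · have : 0 ≤ ((j : ℝ) + 4) / c₁ := by positivity
    have : 0 ≤ 2 * c * κ := by positivity
    have : 0 ≤ 1 / (2 * c * κ) := by positivity
    linarith
  intro Q A B hQ hA1 hA2 hB a b ha hb
  have hQ1 : 1 ≤ Q ∧ (j + 4) / c₁ ≤ Q ∧ 2 * c * κ ≤ Q ∧ 1 / (2 * c * κ) ≤ Q := by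
    have : 0 ≤ ((j : ℝ) + 4) / c₁ := by positivity
    have : 0 ≤ 2 * c * κ := by positivity
    have : 0 ≤ 1 / (2 * c * κ) := by positivity
    refine ⟨?_, ?_, ?_, ?_⟩ <;> linarith
  obtain ⟨hQ1, hQ2, hQ3, hQ4⟩ := hQ1
  have hQ0 : 0 < Q := by linarith
  have hxlow : (j : ℝ) + 4 ≤ c₁ * Q := by
    rw [div_le_iff₀ hc₁] at hQ2
    linarith
  have hA0 : 0 < |A| := lt_of_lt_of_le (by positivity) hA1
  set X : ℝ := (c₂ + 1) * Q with hX
  have hX0 : 0 < X := by positivity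
  have hQX : Q ≤ X := by
    rw [hX]
    nlinarith
  set μ : ℝ := κ * (|A| / Q ^ (j + 3)) with hμ
  have hμ0 : 0 < μ := by positivity
  have hμQ : μ ≤ κ * Q⁻¹ := by
    rw [hμ]
    gcongr
    rw [div_le_iff₀ (by positivity)]
    refine hA2.trans (le_of_eq ?_)
    rw [pow_succ Q (j + 2)]
    field_simp
  have hμQ' : κ / Q ^ 2 ≤ μ := by
    rw [hμ, div_eq_mul_one_div]
    refine mul_le_mul_of_nonneg_left ?_ hκ0.le
    rw [div_le_div_iff₀ (by positivity) (by positivity)]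
    calc 1 * Q ^ (j + 3) = Q ^ (j + 1) * Q ^ 2 := by ring
      _ ≤ |A| * Q ^ 2 := by gcongr
  obtain ⟨σ, hσ, hσA⟩ : ∃ σ : ℝ, (σ = 1 ∨ σ = -1) ∧ σ * A = |A| := by
    rcases abs_choice A with h | h
    · exact ⟨1, Or.inl rfl, by rw [h, one_mul]⟩
    · exact ⟨-1, Or.inr rfl, by rw [h]; ring⟩
  have hσabs : |σ| = 1 := by rcases hσ with rfl | rfl <;> simp
  -- This sign makes the derivative of order `j + 1` positive; negating the phase only conjugates
  -- the sum.
  set τ : ℝ := σ * (-1) ^ (j + 1) with hτ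
  have hτ' : τ = 1 ∨ τ = -1 := by
    rcases hσ with h | h <;> rcases neg_one_pow_eq_or ℝ (j + 1) with h' | h' <;>
      simp [hτ, h, h']
  have hnorm : ‖∑ n ∈ Finset.Icc a b, additiveE (phaseDeriv A B 0 n)‖
      = ‖∑ n ∈ Finset.Icc a b, additiveE (τ * phaseDeriv A B 0 n)‖ := by
    rcases hτ' with h | h
    · simp only [h, one_mul]
    · simp only [h, neg_one_mul]
      rw [norm_sum_additiveE_neg]
  have hmem : ∀ x ∈ Set.Icc (a : ℝ) b, c₁ * Q ≤ x ∧ x ≤ c₂ * Q := fun x hx =>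
    ⟨ha.trans hx.1, hx.2.trans hb⟩
  -- the size of the leading term
  have hDlow : ∀ x ∈ Set.Icc (a : ℝ) b, 2 * μ ≤ |A| * (j + 2).factorial / x ^ (j + 3) := by
    intro x hx
    obtain ⟨hx1, hx2⟩ := hmem x hx
    have hx0 : 0 < x := by linarith
    calc 2 * μ = |A| * (j + 2).factorial / (c₂ * Q) ^ (j + 3) := by
          rw [hμ, hκ, mul_pow]
          field_simp
      _ ≤ _ := by gcongr
  have hDup : ∀ x ∈ Set.Icc (a : ℝ) b, |A| * (j + 2).factorial / x ^ (j + 3) ≤ 2 * ρ * μ := by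
    intro x hx
    obtain ⟨hx1, hx2⟩ := hmem x hx
    calc |A| * (j + 2).factorial / x ^ (j + 3)
        ≤ |A| * (j + 2).factorial / (c₁ * Q) ^ (j + 3) := by gcongr
      _ = 2 * ρ * μ := by
          rw [hμ, hκ, hρ, mul_pow, div_pow]
          field_simp
  have hpow : ((‖∑ n ∈ Finset.Icc a b, additiveE (phaseDeriv A B 0 n)‖) / X) ^ (2 ^ j)
      ≤ C * (μ ^ (1 / (j : ℝ)) + X ^ (-(1 / 2) : ℝ)) := by
    rw [hnorm]
    refine htest (fun i x => τ * phaseDeriv A B i x) a b X μ (hQ1.trans hQX) ?_ hμ0 ?_ ?_ ?_ ?_ ?_ ?_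
    · refine (card_Icc_le_of_bounds (by positivity) (by positivity) ha hb).trans ?_
      rw [hX]
      linarith
    · calc 2 * c * μ ≤ 2 * c * (κ * Q⁻¹) := by gcongr
        _ = 2 * c * κ / Q := by ring
        _ ≤ 1 := by rwa [div_le_one hQ0]
    · calc 1 / (2 * c * μ) ≤ 1 / (2 * c * (κ / Q ^ 2)) := by gcongr
        _ = 1 / (2 * c * κ) * Q ^ 2 := by field_simp
        _ ≤ Q * Q ^ 2 := by gcongr
        _ = Q ^ 3 := by ring
        _ ≤ X ^ 3 := by gcongr
        _ ≤ X ^ j := pow_le_pow_right₀ (hQ1.trans hQX) (by omega)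
    · intro i _ x hx
      have hx0 : 0 < x := lt_of_lt_of_le (by linarith) (hmem x hx).1
      exact (hasDerivAt_phaseDeriv A B i hx0.ne').const_mul τ
    · intro x hx
      have h := (phaseDeriv_mem_Icc hσabs hσA hB (i := j + 1) (by omega) (x := x)
        (by push_cast; linarith [(hmem x hx).1])).1
      have := hDlow x hx
      simp only [hτ]
      refine le_trans ?_ h
      linarith
    · intro x hx
      have h := (phaseDeriv_mem_Icc hσabs hσA hB (i := j + 1) (by omega) (x := x)
        (by push_cast; linarith [(hmem x hx).1])).2
      simp only [hτ]
      refine h.trans ?_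
      calc 3 / 2 * (|A| * (j + 2).factorial / x ^ (j + 3)) ≤ 3 / 2 * (2 * ρ * μ) := by
            gcongr
            exact hDup x hx
        _ = 3 * ρ * μ := by ring
        _ ≤ c * μ := by gcongr
    · intro x hx
      have hx1 := (hmem x hx).1
      have hx0 : 0 < x := lt_of_lt_of_le (by linarith) hx1
      have h := phaseDeriv_mem_Icc hσabs hσA hB (i := j + 2) (by omega) (x := x)
        (by push_cast; linarith)
      have habs : |τ * phaseDeriv A B (j + 2) x|
          = |σ * (-1) ^ (j + 2) * phaseDeriv A B (j + 2) x| := by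
        simp only [hτ, abs_mul, abs_pow, abs_neg, abs_one, one_pow]
      have hD0 : 0 ≤ |A| * (j + 2 + 1).factorial / x ^ (j + 2 + 2) := by positivity
      show |τ * phaseDeriv A B (j + 2) x| ≤ c * μ / X
      rw [habs, abs_of_nonneg (le_trans (by positivity) h.1)]
      refine h.2.trans ?_
      calc 3 / 2 * (|A| * (j + 2 + 1).factorial / x ^ (j + 2 + 2))
          = 3 / 2 * (|A| * (j + 2).factorial / x ^ (j + 3)) * ((j + 3) / x) := by
            rw [Nat.factorial_succ (j + 2)]
            push_cast
            field_simp
            ring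
        _ ≤ 3 / 2 * (2 * ρ * μ) * ((j + 3) / (c₁ * Q)) := by
            gcongr
            exact hDup x hx
        _ = 3 * ρ * ((j + 3) * (c₂ + 1) / c₁) * μ / X := by
            rw [hX]
            field_simp
        _ ≤ c * μ / X := by gcongr
  have hfin : C * (μ ^ (1 / (j : ℝ)) + X ^ (-(1 / 2) : ℝ)) ≤ C' * Q ^ (-(1 / (j : ℝ))) := by
    have f1 : μ ^ (1 / (j : ℝ)) ≤ κ ^ (1 / (j : ℝ)) * Q ^ (-(1 / (j : ℝ))) := by
      rw [Real.rpow_neg hQ0.le, ← Real.inv_rpow hQ0.le, ← Real.mul_rpow hκ0.le (by positivity)]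
      gcongr
    have f2 : X ^ (-(1 / 2) : ℝ) ≤ Q ^ (-(1 / (j : ℝ))) := by
      refine (Real.rpow_le_rpow_of_nonpos hQ0 hQX (by norm_num)).trans ?_
      refine Real.rpow_le_rpow_of_exponent_le hQ1 (neg_le_neg ?_)
      have : (2 : ℝ) ≤ j := by exact_mod_cast (by omega : 2 ≤ j)
      gcongr
    rw [hC', mul_assoc]
    gcongr
    linarith
  have hKpow : (K * Q ^ (-δ)) ^ (2 ^ j) = C' * Q ^ (-(1 / (j : ℝ))) := by
    rw [mul_pow, hK, one_div (((2 ^ j : ℕ) : ℝ)), Real.rpow_inv_natCast_pow hC'0.le (by positivity),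
      ← Real.rpow_mul_natCast hQ0.le]
    congr 2
    rw [hδ]
    have : ((2 ^ j : ℕ) : ℝ) ≠ 0 := by positivity
    field_simp
  have hle : ‖∑ n ∈ Finset.Icc a b, additiveE (phaseDeriv A B 0 n)‖ / X ≤ K * Q ^ (-δ) := by
    rw [← pow_le_pow_iff_left₀ (by positivity) (by positivity) (by positivity : 2 ^ j ≠ 0), hKpow]
    exact hpow.trans hfin
  rw [div_le_iff₀ hX0] at hle
  refine hle.trans (le_of_eq ?_)
  rw [hX]
  ring

/-- `log Q ≤ Q ^ (δ / C) / (δ / C)` trades the power saving for any power of the logarithm. Below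
`Q₀` the trivial bound suffices, as `Q₀ ^ δ * Q ^ (-δ) ≥ 1`. -/
theorem exists_log_power_saving (C c₁ c₂ : ℝ) (hC : 0 < C) (hc₁ : 0 < c₁) (hc₂ : c₁ < c₂) (k : ℕ)
    (hk : 5 ≤ k) : ∃ K : ℝ, 0 < K ∧ ∀ Q A B : ℝ, 1 < Q → Q ^ k ≤ |A| → |A| ≤ Q ^ (k + 1) →
      |B| ≤ |A| → ∀ a b : ℤ, c₁ * Q ≤ a → (b : ℝ) ≤ c₂ * Q →
        ‖∑ n ∈ Finset.Icc a b, additiveE (phaseDeriv A B 0 n)‖ ≤ K * (Q / Real.log Q ^ C) := by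
  obtain ⟨K, δ, Q₀, hK, hδ, hQ₀, hlarge⟩ := exists_power_saving_of_large c₁ c₂ hc₁ hc₂ k hk
  have hc₂0 : 0 < c₂ := hc₁.trans hc₂
  refine ⟨(K + c₂ * Q₀ ^ δ) / (δ / C) ^ C, by positivity, ?_⟩
  intro Q A B hQ hA1 hA2 hB a b ha hb
  have hQ0 : 0 < Q := by linarith
  have hlog : 0 < Real.log Q := Real.log_pos hQ
  have hpow : ‖∑ n ∈ Finset.Icc a b, additiveE (phaseDeriv A B 0 n)‖
      ≤ (K + c₂ * Q₀ ^ δ) * (Q * Q ^ (-δ)) := by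
    rcases le_or_gt Q₀ Q with h | h
    · refine (hlarge Q A B h hA1 hA2 hB a b ha hb).trans ?_
      gcongr
      exact le_add_of_nonneg_right (by positivity)
    · have h1 : ‖∑ n ∈ Finset.Icc a b, additiveE (phaseDeriv A B 0 n)‖ ≤ c₂ * Q := by
        refine (norm_sum_le _ _).trans ?_
        simpa [norm_additiveE] using
          card_Icc_le_of_bounds (by positivity : 0 < c₁ * Q) (by positivity) ha hb
      have h2 : 1 ≤ Q₀ ^ δ * Q ^ (-δ) := by
        rw [Real.rpow_neg hQ0.le, ← div_eq_mul_inv, one_le_div (by positivity)]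
        gcongr
      calc _ ≤ c₂ * Q * 1 := by rwa [mul_one]
        _ ≤ c₂ * Q * (Q₀ ^ δ * Q ^ (-δ)) := by gcongr
        _ = c₂ * Q₀ ^ δ * (Q * Q ^ (-δ)) := by ring
        _ ≤ _ := by
          gcongr
          linarith
  refine hpow.trans ?_
  have hlogC : Real.log Q ^ C ≤ Q ^ δ / (δ / C) ^ C := by
    have h := Real.log_le_rpow_div hQ0.le (by positivity : 0 < δ / C)
    calc Real.log Q ^ C ≤ (Q ^ (δ / C) / (δ / C)) ^ C := by gcongr
      _ = _ := by
        rw [Real.div_rpow (by positivity) (by positivity), ← Real.rpow_mul hQ0.le,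
          div_mul_cancel₀ _ hC.ne']
  rw [div_mul_eq_mul_div, mul_div_assoc]
  gcongr
  rw [div_div, Real.rpow_neg hQ0.le, ← div_eq_mul_inv]
  gcongr
  rwa [le_div_iff₀ (by positivity)] at hlogC

/-! ### Uniformity in the size of `A` -/

/-- The summation `n ≍ Q` ranges over the integers of an arbitrary interval `[M, N]` contained in
`[c₁ Q, c₂ Q]`, where `0 < c₁ < c₂` are arbitrary fixed constants. -/
theorem mainTheorem7 (C U c₁ c₂ : ℝ) (hC : 0 < C) (hU : 5 ≤ U) (hc₁ : 0 < c₁) (hc₂ : c₁ < c₂) :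
    ∃ K : ℝ, 0 < K ∧ ∀ Q A B : ℝ, 1 < Q → Q ^ 5 ≤ |A| → |A| ≤ Q ^ U → |B| ≤ |A| →
      ∀ M N : ℕ, c₁ * Q ≤ (M : ℝ) → (N : ℝ) ≤ c₂ * Q →
        ‖∑ n ∈ Finset.Icc M N,
            additiveE (A * ((n : ℝ) ^ 2 + (n : ℝ) ^ (-2 : ℤ)) +
              B * ((n : ℝ) + (n : ℝ) ^ (-3 : ℤ)))‖
          ≤ K * (Q / Real.log Q ^ C) := by
  choose K hK hbound using exists_log_power_saving C c₁ c₂ hC hc₁ hc₂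
  -- The sum dominates each constant with `5 ≤ k ≤ ⌊U⌋₊`. Smaller `k` carry the dummy value `0`, and
  -- the term `k = 5` makes the sum positive.
  refine ⟨∑ k ∈ (Finset.range (⌊U⌋₊ + 1)).attach,
    if hk : 5 ≤ (k : ℕ) then K k hk else 0, ?_, ?_⟩
  · have h5 : 5 ∈ Finset.range (⌊U⌋₊ + 1) := by
      rw [Finset.mem_range, Nat.lt_succ_iff]
      exact Nat.le_floor (by exact_mod_cast hU)
    refine Finset.sum_pos' (fun k _ => ?_) ⟨⟨5, h5⟩, Finset.mem_attach _ _, ?_⟩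
    · split_ifs with hk
      · exact (hK _ hk).le
      · exact le_rfl
    · rw [dif_pos le_rfl]
      exact hK 5 le_rfl
  intro Q A B hQ hA1 hA2 hB M N hM hN
  have hQ0 : 0 < Q := by linarith
  obtain ⟨k, hk1, hk2⟩ := exists_nat_pow_near ((one_le_pow₀ hQ.le).trans hA1) hQ
  have hk5 : 5 ≤ k := by
    have := (pow_lt_pow_iff_right₀ hQ).mp (hA1.trans_lt hk2)
    omega
  have hkU : k ∈ Finset.range (⌊U⌋₊ + 1) := by
    rw [Finset.mem_range, Nat.lt_succ_iff]
    refine Nat.le_floor ?_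
    have := hk1.trans hA2
    rwa [← Real.rpow_natCast, Real.rpow_le_rpow_left_iff hQ] at this
  have hsum : ∑ n ∈ Finset.Icc M N, additiveE (A * ((n : ℝ) ^ 2 + (n : ℝ) ^ (-2 : ℤ)) +
      B * ((n : ℝ) + (n : ℝ) ^ (-3 : ℤ)))
      = ∑ n ∈ Finset.Icc (M : ℤ) N, additiveE (phaseDeriv A B 0 n) := by
    refine Finset.sum_nbij' (fun n => (n : ℤ)) Int.toNat ?_ ?_ ?_ ?_ fun n _ => by
      rw [phaseDeriv_zero, Int.cast_natCast]
    all_goals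
      intro n hn
      simp only [Finset.mem_Icc] at hn ⊢
      omega
  rw [hsum]
  refine (hbound k hk5 Q A B hQ hk1 hk2.le hB M N (by simpa using hM) (by simpa using hN)).trans ?_
  have hlog : 0 < Real.log Q := Real.log_pos hQ
  gcongr
  have h := Finset.single_le_sum
    (f := fun k : {x // x ∈ Finset.range (⌊U⌋₊ + 1)} => if hk : 5 ≤ (k : ℕ) then K k hk else 0)
    (fun k _ => by
      show 0 ≤ if hk : 5 ≤ (k : ℕ) then K k hk else 0
      split_ifs with hk
      · exact (hK _ hk).le
      · exact le_rfl) (Finset.mem_attach _ ⟨k, hkU⟩)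
  simpa only [dif_pos hk5] using h
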